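/- Let $a,b,c,d$ be real numbers with $a,c>0$ and $b,d<0$, and let $(W_n(z))_{n\ge 0}$ be the sequence of polynomials defined by $W_0(z)=1$, $W_1(z)=z$ and $$W_n(z)=(az+b)\,W_{n-1}(z)+(cz+d)\,W_{n-2}(z)\qquad (n\ge 2).$$ Let $x_A=-b/a$ and $x_B=-d/c$ be the zeros of $A(z)=az+b$ and $B(z)=cz+d$. Call a polynomial with real coefficients real-rooted if all of its complex zeros are real. Then $W_n(z)$ is real-rooted for every $n\ge 0$ if and only if $x_A\le x_B$; and $x_A\le x_B$ is equivalent to $ad\le bc$. -/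

import Mathlib

open Polynomial

/-- The sequence of polynomials `W₀ = 1`, `W₁ = z`,
`Wₙ = (a z + b) Wₙ₋₁ + (c z + d) Wₙ₋₂` for `n ≥ 2`. -/
noncomputable def linRecPoly (a b c d : ℝ) : ℕ → ℝ[X]
  | 0 => 1
  | 1 => X
  | n + 2 => (C a * X + C b) * linRecPoly a b c d (n + 1)
      + (C c * X + C d) * linRecPoly a b c d n

/-- A real polynomial is real-rooted if all of its complex zeros are real. -/
def RealRooted (p : ℝ[X]) : Prop :=
  ∀ z : ℂ, aeval z p = 0 → z.im = 0

/-- The zero `x_A = -b/a` of `A(z) = a z + b`. -/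
noncomputable def xA (a b : ℝ) : ℝ := -b / a

/-- The zero `x_B = -d/c` of `B(z) = c z + d`. -/
noncomputable def xB (c d : ℝ) : ℝ := -d / c

/-! Write `A = az + b`, `B = cz + d`. If `ad ≤ bc`, then `Im (Wₙ₊₁ / Wₙ) > 0` and
`Im (B Wₙ / Wₙ₊₁) ≥ 0` propagate along the recurrence throughout the upper half-plane, so no `Wₙ`
has a zero there.

Conversely, a real-rooted `p` satisfies `|p(x - h)| |p(x + h)| ≤ |p(x + ih)|²` for real `x`, `h`,
factor by factor. Suppose `ad > bc`. At the zero `x` of `A` we have `B = s² > 0`, the characteristic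
roots of the recurrence are `±s`, and they exchange dominance there: along the real axis the larger
modulus has a convex kink, while in the vertical direction both moduli are stationary. Hence for
small `h > 0` the product of the dominant moduli at `x - h` and `x + h` exceeds the square of the
dominant modulus at `x + ih`, and by Binet's formula `p = Wₙ` with `n` large violates the
inequality. -/

open Filter Topology Asymptotics ComplexConjugate

section Recurrence

variable {a b c d : ℝ}

theorem aeval_linRecPoly_add_two (a b c d : ℝ) (z : ℂ) (n : ℕ) :
    aeval z (linRecPoly a b c d (n + 2)) = (a * z + b) * aeval z (linRecPoly a b c d (n + 1))
      + (c * z + d) * aeval z (linRecPoly a b c d n) := by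
  simp [linRecPoly]

theorem realRooted_of_forall_im_pos {p : ℝ[X]} (hp : ∀ z : ℂ, 0 < z.im → aeval z p ≠ 0) :
    RealRooted p := by
  intro z hz
  have hconj : aeval (conj z) p = 0 := by rw [aeval_conj, hz, map_zero]
  by_contra him
  rcases lt_or_gt_of_ne him with hneg | hpos
  · exact hp (conj z) (by simpa using hneg) hconj
  · exact hp z hpos hz

theorem im_aeval_linRecPoly_succ_mul_conj_pos (ha : 0 < a) (hd : d ≤ 0) (h : a * d ≤ b * c)
    {z : ℂ} (hz : 0 < z.im) (n : ℕ) :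
    0 < (aeval z (linRecPoly a b c d (n + 1)) * conj (aeval z (linRecPoly a b c d n))).im ∧
      0 ≤ ((c * z + d) * aeval z (linRecPoly a b c d n) *
        conj (aeval z (linRecPoly a b c d (n + 1)))).im := by
  induction n with
  | zero =>
    have him : ((c * z + d) * conj z).im = -d * z.im := by
      simp only [Complex.mul_im, Complex.add_re, Complex.mul_re, Complex.ofReal_re,
        Complex.ofReal_im, Complex.conj_im, Complex.conj_re, Complex.add_im]
      ring
    simp only [linRecPoly, map_one, aeval_X, mul_one, him]
    exact ⟨hz, mul_nonneg (neg_nonneg.2 hd) hz.le⟩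
  | succ n ih =>
    obtain ⟨hpos, hnonneg⟩ := ih
    rw [aeval_linRecPoly_add_two]
    set u := aeval z (linRecPoly a b c d (n + 1))
    set v := aeval z (linRecPoly a b c d n)
    have hu : 0 < Complex.normSq u := Complex.normSq_pos.2 fun h0 => by simp [h0] at hpos
    have hfirst : (((a * z + b) * u + (c * z + d) * v) * conj u).im =
        a * z.im * Complex.normSq u + ((c * z + d) * v * conj u).im := by
      simp only [Complex.normSq_apply, Complex.mul_im, Complex.mul_re, Complex.add_re,
        Complex.add_im, Complex.ofReal_re, Complex.ofReal_im, Complex.conj_re, Complex.conj_im]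
      ring
    have hsecond : ((c * z + d) * u * conj ((a * z + b) * u + (c * z + d) * v)).im =
        (b * c - a * d) * z.im * Complex.normSq u
          + Complex.normSq (c * z + d) * (u * conj v).im := by
      simp only [map_add, map_mul, Complex.conj_ofReal, Complex.normSq_apply, Complex.mul_im,
        Complex.mul_re, Complex.add_re, Complex.add_im, Complex.ofReal_re, Complex.ofReal_im,
        Complex.conj_re, Complex.conj_im]
      ring
    rw [hfirst, hsecond]
    have hbc : 0 ≤ b * c - a * d := sub_nonneg.2 h
    exact ⟨add_pos_of_pos_of_nonneg (by positivity) hnonneg,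
      add_nonneg (mul_nonneg (mul_nonneg hbc hz.le) hu.le)
        (mul_nonneg (Complex.normSq_nonneg _) hpos.le)⟩

theorem realRooted_linRecPoly (ha : 0 < a) (hd : d ≤ 0) (h : a * d ≤ b * c) (n : ℕ) :
    RealRooted (linRecPoly a b c d n) :=
  realRooted_of_forall_im_pos fun z hz h0 => by
    simpa [h0] using (im_aeval_linRecPoly_succ_mul_conj_pos ha hd h hz n).1

end Recurrence

theorem norm_sub_mul_norm_add_le (t h : ℝ) :
    ‖(t - h : ℂ)‖ * ‖(t + h : ℂ)‖ ≤ ‖(t + h * Complex.I : ℂ)‖ ^ 2 := by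
  have hI : ‖(t + h * Complex.I : ℂ)‖ ^ 2 = t ^ 2 + h ^ 2 := by
    rw [← Complex.normSq_eq_norm_sq, Complex.normSq_add_mul_I]
  have hprod : (t - h : ℂ) * (t + h) = ((t ^ 2 - h ^ 2 : ℝ) : ℂ) := by push_cast; ring
  rw [hI, ← norm_mul, hprod, Complex.norm_real, Real.norm_eq_abs, abs_le]
  constructor <;> nlinarith [sq_nonneg t, sq_nonneg h]

theorem RealRooted.norm_aeval_sub_mul_norm_aeval_add_le {p : ℝ[X]} (hp : RealRooted p)
    (x h : ℝ) :
    ‖aeval (x - h : ℂ) p‖ * ‖aeval (x + h : ℂ) p‖ ≤ ‖aeval (x + h * Complex.I : ℂ) p‖ ^ 2 := by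
  have hnorm (w : ℂ) : ‖aeval w p‖ =
      ‖p.leadingCoeff‖ * ((p.aroots ℂ).map fun r => ‖w - r‖).prod := by
    rw [(IsAlgClosed.splits _).aeval_eq_prod_aroots, norm_mul, norm_algebraMap']
    exact congrArg _ ((map_multiset_prod (normHom : ℂ →*₀ ℝ) _).trans (by simp [Multiset.map_map]))
  have hroot : ∀ r ∈ p.aroots ℂ,
      ‖(x - h - r : ℂ)‖ * ‖(x + h - r : ℂ)‖ ≤ ‖(x + h * Complex.I - r : ℂ)‖ ^ 2 := by
    intro r hr
    obtain ⟨t, rfl⟩ : ∃ t : ℝ, (t : ℂ) = r :=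
      ⟨r.re, Complex.ext rfl (hp r (mem_aroots'.1 hr).2).symm⟩
    convert norm_sub_mul_norm_add_le (x - t) h using 3 <;> push_cast <;> ring
  have hprod := Multiset.prod_map_le_prod_map₀ _ _ (fun r _ => by positivity) hroot
  rw [Multiset.prod_map_mul, Multiset.prod_map_pow] at hprod
  rw [hnorm, hnorm, hnorm, mul_mul_mul_comm, mul_pow, ← sq]
  gcongr

/-- `l` and `k` are the roots, counted with multiplicity, of the characteristic equation
`t² = (a z + b) t + (c z + d)` of the recurrence at the point `z`. -/
def IsCharRootPair (a b c d : ℝ) (z l k : ℂ) : Prop :=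
  l + k = a * z + b ∧ l * k = -(c * z + d)

namespace IsCharRootPair

variable {a b c d : ℝ} {z l k : ℂ}

theorem symm (hlk : IsCharRootPair a b c d z l k) : IsCharRootPair a b c d z k l :=
  ⟨by rw [add_comm, hlk.1], by rw [mul_comm, hlk.2]⟩

theorem sub_mul_sub (hlk : IsCharRootPair a b c d z l k) :
    (z - l) * (z - k) = z ^ 2 - (a * z + b) * z - (c * z + d) := by
  linear_combination -z * hlk.1 + hlk.2

theorem aeval_linRecPoly (hlk : IsCharRootPair a b c d z l k) (hne : l ≠ k) (n : ℕ) :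
    aeval z (linRecPoly a b c d n) = (z - k) / (l - k) * l ^ n - (z - l) / (l - k) * k ^ n := by
  have hsub : l - k ≠ 0 := sub_ne_zero.2 hne
  induction n using Nat.twoStepInduction with
  | zero =>
    simp only [linRecPoly, map_one, pow_zero, mul_one]
    field_simp
    ring
  | one =>
    simp only [linRecPoly, aeval_X, pow_one]
    field_simp
    ring
  | more n h0 h1 =>
    rw [aeval_linRecPoly_add_two, h0, h1]
    have hl : l ^ 2 = (a * z + b) * l + (c * z + d) := by
      linear_combination l * hlk.1 - hlk.2
    have hk : k ^ 2 = (a * z + b) * k + (c * z + d) := by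
      linear_combination k * hlk.1 - hlk.2
    linear_combination
      (z - l) / (l - k) * k ^ n * hk - (z - k) / (l - k) * l ^ n * hl

theorem isBigO_aeval_linRecPoly (hlk : IsCharRootPair a b c d z l k) (hne : l ≠ k) :
    (fun n => aeval z (linRecPoly a b c d n)) =O[atTop] fun n => max ‖l‖ ‖k‖ ^ n := by
  have hle {w : ℂ} (hw : ‖w‖ ≤ max ‖l‖ ‖k‖) :
      (fun n : ℕ => w ^ n) =O[atTop] fun n => max ‖l‖ ‖k‖ ^ n :=
    .of_norm_le fun n => by rw [norm_pow]; gcongr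
  simp only [hlk.aeval_linRecPoly hne]
  exact ((hle (le_max_left _ _)).const_mul_left _).sub ((hle (le_max_right _ _)).const_mul_left _)

theorem pow_isBigO_aeval_linRecPoly (hlk : IsCharRootPair a b c d z l k) (hlt : ‖k‖ < ‖l‖)
    (hz : z ≠ k) :
    (fun n => l ^ n) =O[atTop] fun n => aeval z (linRecPoly a b c d n) := by
  have hne : l ≠ k := fun h => hlt.ne' (congrArg norm h)
  have hsmall : (fun n => (z - l) / (l - k) * k ^ n) =o[atTop]
      fun n => (z - k) / (l - k) * l ^ n := by
    refine .const_mul_left (.const_mul_right (by simp [sub_eq_zero, hne, hz]) ?_) _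
    exact .of_norm_norm (by simpa using isLittleO_pow_pow_of_lt_left (norm_nonneg k) hlt)
  have hmain := hsmall.right_isBigO_sub
  simp only [hlk.aeval_linRecPoly hne]
  exact (isBigO_self_const_mul (by simp [div_eq_zero_iff, sub_eq_zero, hne, hz]) _ _).trans hmain

end IsCharRootPair

theorem norm_mul_norm_le_max_sq_of_forall_realRooted {a b c d : ℝ}
    (hW : ∀ n, RealRooted (linRecPoly a b c d n)) {x h : ℝ} {l₁ k₁ l₂ k₂ l₃ k₃ : ℂ}
    (h₁ : IsCharRootPair a b c d (x - h) l₁ k₁) (hlt₁ : ‖k₁‖ < ‖l₁‖) (hz₁ : (x - h : ℂ) ≠ k₁)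
    (h₂ : IsCharRootPair a b c d (x + h) l₂ k₂) (hlt₂ : ‖k₂‖ < ‖l₂‖) (hz₂ : (x + h : ℂ) ≠ k₂)
    (h₃ : IsCharRootPair a b c d (x + h * Complex.I) l₃ k₃) (hne₃ : l₃ ≠ k₃) :
    ‖l₁‖ * ‖l₂‖ ≤ max ‖l₃‖ ‖k₃‖ ^ 2 := by
  by_contra! hlt
  have hself : (fun n => (l₁ * l₂) ^ n) =o[atTop] fun n => (l₁ * l₂) ^ n :=
    calc (fun n => (l₁ * l₂) ^ n)
      _ =O[atTop] fun n => aeval (x - h : ℂ) (linRecPoly a b c d n) *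
            aeval (x + h : ℂ) (linRecPoly a b c d n) := by
          simpa only [mul_pow] using (h₁.pow_isBigO_aeval_linRecPoly hlt₁ hz₁).mul
            (h₂.pow_isBigO_aeval_linRecPoly hlt₂ hz₂)
      _ =O[atTop] fun n => aeval (x + h * Complex.I : ℂ) (linRecPoly a b c d n) ^ 2 :=
          .of_norm_norm <| .of_norm_le fun n => by
            simpa using (hW n).norm_aeval_sub_mul_norm_aeval_add_le x h
      _ =O[atTop] fun n => (max ‖l₃‖ ‖k₃‖ ^ 2) ^ n := by
          simpa only [pow_right_comm] using (h₃.isBigO_aeval_linRecPoly hne₃).pow 2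
      _ =o[atTop] fun n => (l₁ * l₂) ^ n :=
          .of_norm_right (by
            simpa using isLittleO_pow_pow_of_lt_left (sq_nonneg (max ‖l₃‖ ‖k₃‖)) hlt)
  have hl₁ : l₁ ≠ 0 := norm_pos_iff.1 ((norm_nonneg _).trans_lt hlt₁)
  have hl₂ : l₂ ≠ 0 := norm_pos_iff.1 ((norm_nonneg _).trans_lt hlt₂)
  exact isLittleO_irrefl (.of_forall fun n => by positivity) hself

theorem eventually_lt_of_hasDerivAt_lt {f g : ℝ → ℝ} {f' g' x : ℝ} (hf : HasDerivAt f f' x)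
    (hg : HasDerivAt g g' x) (hfg : f x = g x) (hlt : f' < g') : ∀ᶠ y in 𝓝[>] x, f y < g y := by
  have hslope := (hasDerivAt_iff_tendsto_slope.1 (hg.sub hf)).mono_left (nhdsGT_le_nhdsNE x)
  filter_upwards [hslope.eventually_const_lt (sub_pos.2 hlt), self_mem_nhdsWithin]
    with y hy hxy
  simpa using pos_of_slope_pos hxy hy (by simp [hfg])

theorem eventually_eval_ne_zero {R : Type*} [CommRing R] [IsDomain R] [TopologicalSpace R]
    [T1Space R] {p : R[X]} (hp : p ≠ 0) (x : R) : ∀ᶠ y in 𝓝[≠] x, p.eval y ≠ 0 :=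
  (p.finite_setOfPred_isRoot hp).eventually_cofinite_notMem.filter_mono (nhdsNE_le_cofinite x)

section CharRoot

variable {a b c d x s : ℝ}

/-- The root of the characteristic equation at `z` selected by the sign `ε = ±1` of the principal
square root of the discriminant. -/
noncomputable def charRoot (a b c d ε : ℝ) (z : ℂ) : ℂ :=
  (a * z + b + ε * Complex.sqrt ((a * z + b) ^ 2 + 4 * (c * z + d))) / 2

theorem isCharRootPair_charRoot (a b c d : ℝ) (z : ℂ) :
    IsCharRootPair a b c d z (charRoot a b c d 1 z) (charRoot a b c d (-1) z) := by
  have hsq : Complex.sqrt ((a * z + b) ^ 2 + 4 * (c * z + d)) ^ 2 =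
      (a * z + b) ^ 2 + 4 * (c * z + d) := Complex.cpow_ofNat_inv_pow _ 2
  refine ⟨?_, ?_⟩ <;> simp only [charRoot, Complex.ofReal_one, Complex.ofReal_neg]
  · ring
  · linear_combination -hsq / 4

theorem complexSqrt_four_mul_sq (hs : 0 ≤ s) : Complex.sqrt (4 * s ^ 2) = 2 * s := by
  rw [Complex.sqrt_of_nonneg (by norm_cast; positivity)]
  norm_cast
  rw [show 4 * s ^ 2 = (2 * s) ^ 2 by ring, Real.sqrt_sq (by positivity)]

theorem charRoot_eq_mul (hA : a * x + b = 0) (hs : 0 ≤ s) (hB : s ^ 2 = c * x + d) (ε : ℝ) :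
    charRoot a b c d ε x = (ε * s : ℝ) := by
  have hA' : (a * x + b : ℂ) = 0 := by exact_mod_cast hA
  have hB' : (c * x + d : ℂ) = s ^ 2 := by exact_mod_cast hB.symm
  rw [charRoot, hA', hB', zero_pow two_ne_zero, zero_add, zero_add, complexSqrt_four_mul_sq hs]
  push_cast
  ring

theorem hasDerivAt_charRoot (hA : a * x + b = 0) (hs : 0 < s) (hB : s ^ 2 = c * x + d) (ε : ℝ) :
    HasDerivAt (charRoot a b c d ε) ((a + ε * c / s) / 2 : ℝ) (x : ℂ) := by
  have hA' : (a * x + b : ℂ) = 0 := by exact_mod_cast hA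
  have hdisc : ((a * x + b) ^ 2 + 4 * (c * x + d) : ℂ) = 4 * s ^ 2 := by
    have hB' : (c * x + d : ℂ) = s ^ 2 := by exact_mod_cast hB.symm
    rw [hA', hB', zero_pow two_ne_zero, zero_add]
  have hlin (p q : ℝ) : HasDerivAt (fun z : ℂ => (p * z + q : ℂ)) p x := by
    simpa using ((hasDerivAt_id (x : ℂ)).const_mul (p : ℂ)).add_const (q : ℂ)
  have hslit : ((a * x + b) ^ 2 + 4 * (c * x + d) : ℂ) ∈ Complex.slitPlane := by
    rw [hdisc]; norm_cast; exact Complex.ofReal_mem_slitPlane.2 (by positivity)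
  have hpow : (4 * s ^ 2 : ℂ) ^ (-1 / 2 : ℂ) = (2 * s : ℂ)⁻¹ := by
    rw [neg_div, one_div, Complex.cpow_neg, ← Complex.sqrt, complexSqrt_four_mul_sq hs.le]
  have hsqrt := (Complex.hasDerivAt_sqrt hslit).comp (x : ℂ)
    (((hlin a b).fun_pow 2).fun_add ((hlin c d).const_mul 4))
  refine (((hlin a b).add (hsqrt.const_mul (ε : ℂ))).div_const 2).congr_deriv ?_
  rw [hdisc, hpow, hA']
  have hs0 : (s : ℂ) ≠ 0 := by exact_mod_cast hs.ne'
  push_cast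
  field_simp
  ring

theorem hasDerivAt_norm_sq_charRoot (hA : a * x + b = 0) (hs : 0 < s) (hB : s ^ 2 = c * x + d)
    {ε : ℝ} (hε : ε ^ 2 = 1) (u : ℂ) :
    HasDerivAt (fun h : ℝ => ‖charRoot a b c d ε (x + h * u)‖ ^ 2) ((c + ε * a * s) * u.re) 0 := by
  have hline : HasDerivAt (fun h : ℝ => (x + h * u : ℂ)) u 0 := by
    simpa using ((hasDerivAt_id (0 : ℝ)).ofReal_comp.mul_const u).const_add (x : ℂ)
  have hroot : HasDerivAt (fun h : ℝ => charRoot a b c d ε (x + h * u))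
      (u • (((a + ε * c / s) / 2 : ℝ) : ℂ)) 0 :=
    (hasDerivAt_charRoot hA hs hB ε).scomp_of_eq 0 hline (by simp)
  refine hroot.norm_sq.congr_deriv ?_
  rw [Complex.ofReal_zero, zero_mul, add_zero, charRoot_eq_mul hA hs.le hB, Complex.inner]
  simp only [Complex.conj_ofReal, smul_eq_mul, Complex.re_mul_ofReal]
  field_simp
  linear_combination c * u.re * hε

theorem norm_charRoot_sq (hA : a * x + b = 0) (hs : 0 ≤ s) (hB : s ^ 2 = c * x + d)
    {ε : ℝ} (hε : ε ^ 2 = 1) : ‖charRoot a b c d ε x‖ ^ 2 = s ^ 2 := by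
  rw [charRoot_eq_mul hA hs hB, Complex.norm_real, Real.norm_eq_abs, sq_abs, mul_pow, hε, one_mul]

theorem eventually_norm_charRoot_lt (hA : a * x + b = 0) (hs : 0 < s) (hB : s ^ 2 = c * x + d)
    {ε δ : ℝ} (hε : ε ^ 2 = 1) (hδ : δ ^ 2 = 1) {u : ℂ}
    (hlt : (c + ε * a * s) * u.re < (c + δ * a * s) * u.re) :
    ∀ᶠ h : ℝ in 𝓝[>] 0,
      ‖charRoot a b c d ε (x + h * u)‖ < ‖charRoot a b c d δ (x + h * u)‖ := by
  have hsq := eventually_lt_of_hasDerivAt_lt (hasDerivAt_norm_sq_charRoot hA hs hB hε u)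
    (hasDerivAt_norm_sq_charRoot hA hs hB hδ u)
    (by simp [norm_charRoot_sq hA hs.le hB, hε, hδ]) hlt
  filter_upwards [hsq] with h hh
  exact lt_of_pow_lt_pow_left₀ 2 (norm_nonneg _) hh

theorem eventually_norm_charRoot_sq_lt_mul (ha : 0 < a) (hA : a * x + b = 0) (hs : 0 < s)
    (hB : s ^ 2 = c * x + d) {ε : ℝ} (hε : ε ^ 2 = 1) :
    ∀ᶠ h : ℝ in 𝓝[>] 0, ‖charRoot a b c d ε (x + h * Complex.I)‖ ^ 2 <
      ‖charRoot a b c d (-1) (x - h)‖ * ‖charRoot a b c d 1 (x + h)‖ := by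
  have hvert := (hasDerivAt_norm_sq_charRoot hA hs hB hε Complex.I).fun_pow 2
  have hhor := (hasDerivAt_norm_sq_charRoot hA hs hB (ε := -1) (by norm_num) (-1)).fun_mul
    (hasDerivAt_norm_sq_charRoot hA hs hB (one_pow 2) 1)
  have hgain : 0 < 2 * (a * s) * s ^ 2 := by positivity
  have hsq := eventually_lt_of_hasDerivAt_lt hvert hhor
    (by
      simp only [Complex.ofReal_zero, zero_mul, add_zero, norm_charRoot_sq hA hs.le hB, hε,
        neg_one_sq, one_pow]
      ring)
    (by
      simp only [Complex.ofReal_zero, zero_mul, add_zero, norm_charRoot_sq hA hs.le hB, hε,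
        neg_one_sq, one_pow, Complex.I_re, Complex.neg_re, Complex.one_re, mul_zero]
      linarith)
  filter_upwards [hsq] with h hh
  rw [← mul_pow, mul_neg_one, ← sub_eq_add_neg, mul_one] at hh
  exact lt_of_pow_lt_pow_left₀ 2 (by positivity) hh

theorem eventually_charRoot_ne (hA : a * x + b = 0) (hs : 0 < s) (hB : s ^ 2 = c * x + d) :
    ∀ᶠ z in 𝓝 (x : ℂ), charRoot a b c d 1 z ≠ charRoot a b c d (-1) z := by
  refine ((hasDerivAt_charRoot hA hs hB 1).continuousAt.ne_iff_eventually_ne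
    (hasDerivAt_charRoot hA hs hB (-1)).continuousAt).1 ?_
  rw [charRoot_eq_mul hA hs.le hB, charRoot_eq_mul hA hs.le hB, Ne, Complex.ofReal_inj]
  linarith

end CharRoot

theorem tendsto_add_ofReal_mul_nhdsNE (z : ℂ) {u : ℂ} (hu : u ≠ 0) :
    Tendsto (fun h : ℝ => z + h * u) (𝓝[>] 0) (𝓝[≠] z) := by
  refine tendsto_nhdsWithin_iff.2 ⟨?_, ?_⟩
  · exact (Continuous.tendsto' (by fun_prop) 0 _ (by simp)).mono_left nhdsWithin_le_nhds
  · filter_upwards [self_mem_nhdsWithin] with h hh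
    simpa [hu] using (Set.mem_Ioi.1 hh).ne'

theorem eventually_ne_of_isCharRootPair {d : ℝ} (hd : d ≠ 0) (a b c : ℝ) (z : ℂ) :
    ∀ᶠ w in 𝓝[≠] z, ∀ l k : ℂ, IsCharRootPair a b c d w l k → w ≠ k := by
  have hchar : (X ^ 2 - (C (a : ℂ) * X + C (b : ℂ)) * X - (C (c : ℂ) * X + C (d : ℂ))) ≠ 0 :=
    fun h0 => hd (by simpa using congrArg (eval 0) h0)
  filter_upwards [eventually_eval_ne_zero hchar z] with w hw l k hlk hwk
  have hprod := hlk.sub_mul_sub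
  rw [sub_eq_zero.2 hwk, mul_zero] at hprod
  apply hw
  simp only [eval_sub, eval_add, eval_mul, eval_pow, eval_X, eval_C, hprod]

theorem not_forall_realRooted_linRecPoly {a b c d x : ℝ} (ha : 0 < a) (hd : d ≠ 0)
    (hA : a * x + b = 0) (hB : 0 < c * x + d) : ¬ ∀ n, RealRooted (linRecPoly a b c d n) := by
  intro hW
  obtain ⟨s, hs, hsB⟩ : ∃ s, 0 < s ∧ s ^ 2 = c * x + d :=
    ⟨√(c * x + d), Real.sqrt_pos.2 hB, Real.sq_sqrt hB.le⟩
  have has : 0 < a * s := mul_pos ha hs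
  have hpair := isCharRootPair_charRoot a b c d
  have hneNear := eventually_ne_of_isCharRootPair hd a b c x
  have hltLeft := eventually_norm_charRoot_lt hA hs hsB (one_pow 2) neg_one_sq (u := -1)
    (by simp only [Complex.neg_re, Complex.one_re]; linarith)
  have hltRight := eventually_norm_charRoot_lt hA hs hsB neg_one_sq (one_pow 2) (u := 1)
    (by simp only [Complex.one_re]; linarith)
  have hneLeft := (tendsto_add_ofReal_mul_nhdsNE x (neg_ne_zero.2 one_ne_zero)).eventually hneNear
  have hneRight := (tendsto_add_ofReal_mul_nhdsNE x one_ne_zero).eventually hneNear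
  have hneUp := ((tendsto_add_ofReal_mul_nhdsNE x Complex.I_ne_zero).mono_right
    nhdsWithin_le_nhds).eventually (eventually_charRoot_ne hA hs hsB)
  have hltUp := eventually_norm_charRoot_sq_lt_mul ha hA hs hsB (one_pow 2)
  have hltUp' := eventually_norm_charRoot_sq_lt_mul ha hA hs hsB neg_one_sq
  obtain ⟨h, hltLeft, hltRight, hneLeft, hneRight, hneUp, hltUp, hltUp'⟩ :=
    (hltLeft.and <| hltRight.and <| hneLeft.and <| hneRight.and <| hneUp.and <|
      hltUp.and hltUp').exists
  simp only [mul_neg_one, ← sub_eq_add_neg, mul_one] at hltLeft hltRight hneLeft hneRight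
  have hle := norm_mul_norm_le_max_sq_of_forall_realRooted hW
    (hpair _).symm hltLeft (hneLeft _ _ (hpair _).symm)
    (hpair _) hltRight (hneRight _ _ (hpair _)) (hpair _) hneUp
  rcases max_choice ‖charRoot a b c d 1 (x + h * Complex.I)‖
    ‖charRoot a b c d (-1) (x + h * Complex.I)‖ with hmax | hmax
  all_goals rw [hmax] at hle; linarith

theorem mul_le_mul_of_forall_realRooted_linRecPoly {a b c d : ℝ} (ha : 0 < a) (hd : d ≠ 0)
    (hW : ∀ n, RealRooted (linRecPoly a b c d n)) : a * d ≤ b * c := by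
  by_contra! hlt
  have hA : a * (-b / a) + b = 0 := by field_simp; ring
  have hB : 0 < c * (-b / a) + d :=
    pos_of_mul_pos_right (a := a) (by linear_combination hlt - c * hA) ha.le
  exact not_forall_realRooted_linRecPoly ha hd hA hB hW

theorem mainTheorem2_general (a b c d : ℝ) (ha : 0 < a) (hd : d < 0) :
    (∀ n, RealRooted (linRecPoly a b c d n)) ↔ a * d ≤ b * c :=
  ⟨mul_le_mul_of_forall_realRooted_linRecPoly ha hd.ne, realRooted_linRecPoly ha hd.le⟩

theorem xA_le_xB_iff {a b c d : ℝ} (ha : 0 < a) (hc : 0 < c) :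
    xA a b ≤ xB c d ↔ a * d ≤ b * c := by
  rw [xA, xB, div_le_div_iff₀ ha hc]
  constructor <;> intro h <;> linarith

theorem mainTheorem2 (a b c d : ℝ) (ha : 0 < a) (hb : b < 0) (hc : 0 < c) (hd : d < 0) :
    ((∀ n : ℕ, RealRooted (linRecPoly a b c d n)) ↔ xA a b ≤ xB c d) ∧
      (xA a b ≤ xB c d ↔ a * d ≤ b * c) := by
  rw [xA_le_xB_iff ha hc]
  exact ⟨mainTheorem2_general a b c d ha hd, Iff.rfl⟩
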